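/- Let $n\ge 2$ and let $R\in\mathbb{R}^{n\times n}$ be an entrywise nonnegative matrix (not necessarily lazy) with entrywise positive vectors $u,v$ such that $u^{T}R=u^{T}$, $Rv=v$ and $\langle u,v\rangle=1$ (so $1$ is the Perron–Frobenius eigenvalue of $R$). Let $\kappa=\min_i u_iv_i$, let $D_u,D_v$ be the diagonal matrices with diagonals $u,v$, and let $$\phi(R)=\min_{\emptyset\ne S\subsetneq[n]}\frac{\langle \mathbf 1_S,D_uRD_v\mathbf 1_{\overline S}\rangle}{\min\{\langle \mathbf 1_S,D_uRD_v\mathbf 1\rangle,\langle \mathbf 1_{\overline S},D_uRD_v\mathbf 1\rangle\}}$$ be the edge expansion of $R$. Let $0<\epsilon\le n/\kappa$. Call a matrix $P$ $\epsilon$-mixed if $\|D_u(P-v u^{T})x\|_1\le\epsilon$ for every $x\in\mathbb{R}^n$ with $\|D_ux\|_1=1$. Let $\tau$ be the smallest real $t\ge 0$ such that $\exp(t(R-I))$ is $\epsilon$-mixed. If $\phi(R)>0$, then $\tau$ exists and $$\frac{\frac12-\epsilon}{\phi(R)}\ \le\ \tau\ \le\ \frac{100\,\ln\!\left(\frac{n}{\kappa\,\epsilon}\right)}{\phi(R)^2}.$$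 The same two bounds hold for the smallest integer $k\ge 0$ such that $\exp(R-I)^k$ is $\epsilon$-mixed, which also exists. If $\phi(R)=0$ and $\epsilon<\frac12$, then there is no such $t$ and no such $k$ (the mixing times are infinite). -/

import Mathlib

open scoped Matrix

namespace NonnegMatrix

variable {n : ℕ}

/-- `u` and `v` are positive left and right eigenvectors of the (entrywise) nonnegative matrix `R`
for the eigenvalue `1`, normalized so that `⟨u, v⟩ = 1`. Positivity of `u` and `v` forces `1` to be
the Perron-Frobenius eigenvalue of `R`. -/
structure IsPFPair (R : Matrix (Fin n) (Fin n) ℝ) (u v : Fin n → ℝ) : Prop where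
  nonneg : ∀ i j, 0 ≤ R i j
  left_pos : ∀ i, 0 < u i
  right_pos : ∀ i, 0 < v i
  left_eigen : u ᵥ* R = u
  right_eigen : R *ᵥ v = v
  normalized : u ⬝ᵥ v = 1

/-- The entry sum `⟨1_S, D_u R D_v 1_T⟩`. -/
noncomputable def flow (R : Matrix (Fin n) (Fin n) ℝ) (u v : Fin n → ℝ) (S T : Finset (Fin n)) :
    ℝ :=
  ∑ i ∈ S, ∑ j ∈ T, u i * R i j * v j

/-- The edge expansion `φ_S(R)` of the cut `S`. -/
noncomputable def cutExpansion (R : Matrix (Fin n) (Fin n) ℝ) (u v : Fin n → ℝ)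
    (S : Finset (Fin n)) : ℝ :=
  flow R u v S Sᶜ / min (flow R u v S Finset.univ) (flow R u v Sᶜ Finset.univ)

/-- The edge expansion `φ(R)`, computed with the positive eigenvectors `u` and `v`: the minimum of
`φ_S(R)` over all cuts `S` other than the empty and the full one (a nonempty finite family of cuts
as soon as `2 ≤ n`). -/
noncomputable def edgeExpansion (R : Matrix (Fin n) (Fin n) ℝ) (u v : Fin n → ℝ) : ℝ :=
  ⨅ S : {S : Finset (Fin n) // S.Nonempty ∧ Sᶜ.Nonempty}, cutExpansion R u v S

/-- `κ = min_i u_i v_i`. -/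
noncomputable def kappa (u v : Fin n → ℝ) : ℝ := ⨅ i, u i * v i

/-- The weighted norm `‖D_u x‖₁`. -/
noncomputable def weightedL1 (u x : Fin n → ℝ) : ℝ := ∑ i, |(Matrix.diagonal u *ᵥ x) i|

/-- The operator `P` is within `ε` of `v uᵀ`: `‖D_u (P - v uᵀ) x‖₁ ≤ ε` for every `x` with
`‖D_u x‖₁ = 1`. -/
def IsMixed (P : Matrix (Fin n) (Fin n) ℝ) (u v : Fin n → ℝ) (ε : ℝ) : Prop :=
  ∀ x : Fin n → ℝ, weightedL1 u x = 1 → weightedL1 u ((P - Matrix.vecMulVec v u) *ᵥ x) ≤ ε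

/-- The real times `t ≥ 0` at which the continuous time operator `exp (t (R - I))` is mixed. -/
def mixedTimes (R : Matrix (Fin n) (Fin n) ℝ) (u v : Fin n → ℝ) (ε : ℝ) : Set ℝ :=
  {t | 0 ≤ t ∧ IsMixed (NormedSpace.exp (t • (R - 1))) u v ε}

/-- The numbers of steps `k` after which the matrix `P` is mixed. -/
def mixedSteps (P : Matrix (Fin n) (Fin n) ℝ) (u v : Fin n → ℝ) (ε : ℝ) : Set ℕ :=
  {k | IsMixed (P ^ k) u v ε}

/-- `τ` is the mixing time of `exp (t (R - I))`: the smallest real time at which it is mixed. -/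
def IsContinuousMixingTime (R : Matrix (Fin n) (Fin n) ℝ) (u v : Fin n → ℝ) (ε τ : ℝ) : Prop :=
  IsLeast (mixedTimes R u v ε) τ

/-- `k` is the mixing time of the matrix `P`: the smallest number of steps after which it is
mixed. -/
def IsMixingTime (P : Matrix (Fin n) (Fin n) ℝ) (u v : Fin n → ℝ) (ε : ℝ) (k : ℕ) : Prop :=
  IsLeast (mixedSteps P u v ε) k

end NonnegMatrix

/-! The weights `A i j = u i * R i j * v j` have both marginals equal to the probability `p i = u i
* v i`, so the problem reduces to a chain with stationary law `p`, not necessarily reversible.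

Upper bound: for `y = exp (t (R - 1)) w` with `u ⬝ᵥ w = 0`, put `g = y / v`. The energy `∑ p g²` has
derivative `-∑ A (g i - g j)²` (`hasDerivAt_energy`), which needs the two marginals but no symmetry
of `A`. `cheeger_inequality` bounds this by `-φ²/4` times the energy, so the energy decays
exponentially (`energy_le`). Cauchy–Schwarz bounds the squared weighted `ℓ¹` norm by the energy,
which starts at most at `1/κ`.

Lower bound: start from `v` restricted to an optimal cut `S` of mass at most `1/2`. Mass leaves `S`
at rate at most the flow across the cut, so at time `t` at most a fraction `φ t` has left, whereas
mixing requires at least `1/2 - ε` (`half_sub_le_of_mem_mixedTimes`). With `φ = 0` the same estimate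
rules out mixing when `ε < 1/2`.

The set of mixed times is closed, so the continuous mixing time is attained. -/

namespace NonnegMatrix

/-! ### Cheeger's inequality for weights with equal marginals. -/

section Cheeger

variable {ι : Type*} [Fintype ι] {A : ι → ι → ℝ} {p : ι → ℝ} {φ : ℝ}

/-- Co-area inequality: a nonnegative function supported on at most half of the mass has total
positive variation at least the expansion times its mean. -/
theorem mul_sum_le_sum_posPart_sub [DecidableEq ι]
    (hcut : ∀ S : Finset ι, ∑ i ∈ S, p i ≤ 1 / 2 →
      φ * ∑ i ∈ S, p i ≤ ∑ i ∈ S, ∑ j ∈ Sᶜ, A i j)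
    (hp : ∀ i, 0 ≤ p i) (f : ι → ℝ) (hf : ∀ i, 0 ≤ f i)
    (hsupp : ∑ i with 0 < f i, p i ≤ 1 / 2) :
    φ * ∑ i, p i * f i ≤ ∑ i, ∑ j, A i j * max (f i - f j) 0 := by
  induction hN : (Finset.univ.filter fun i => 0 < f i).card using Nat.strong_induction_on
    generalizing f with
  | _ N ih =>
    set S := Finset.univ.filter fun i => 0 < f i with hS
    have memS : ∀ i, i ∈ S ↔ 0 < f i := by simp [hS]
    rcases S.eq_empty_or_nonempty with h0 | hne
    · have hz : ∀ i, f i = 0 := fun i => by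
        by_contra hi
        have : i ∈ S := (memS i).2 (lt_of_le_of_ne (hf i) (Ne.symm hi))
        simp [h0] at this
      simp [hz]
    · obtain ⟨k, hkS, hkmin⟩ := S.exists_min_image f hne
      have hk := (memS k).1 hkS
      -- Peel off the lowest positive level: `f = f' + f k · 1_S`. Both sides of the inequality
      -- split along this decomposition, and the support shrinks because `k` leaves it.
      let f' : ι → ℝ := fun i => if i ∈ S then f i - f k else 0
      have hf' : ∀ i, 0 ≤ f' i := fun i => by
        by_cases hi : i ∈ S
        · simpa [f', hi] using hkmin i hi
        · simp [f', hi]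
      have hsub : (Finset.univ.filter fun i => 0 < f' i) ⊂ S := by
        refine (Finset.ssubset_iff_of_subset ?_).2 ⟨k, hkS, by simp [f']⟩
        intro i hi
        by_contra hiS
        simp [f', hiS] at hi
      have key := ih _ (hN ▸ Finset.card_lt_card hsub) f' hf'
        ((Finset.sum_le_sum_of_subset_of_nonneg hsub.1 fun i _ _ => hp i).trans hsupp) rfl
      have hleft : ∑ i, p i * f i = ∑ i, p i * f' i + f k * ∑ i ∈ S, p i := by
        rw [← Finset.sum_filter_add_sum_filter_not Finset.univ (fun i => i ∈ S) (fun i => p i * f i),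
          ← Finset.sum_filter_add_sum_filter_not Finset.univ (fun i => i ∈ S) (fun i => p i * f' i)]
        have h1 : ∀ i ∈ Finset.univ.filter (fun i => ¬ i ∈ S), p i * f i = p i * f' i := by
          intro i hi
          have hi' : i ∉ S := by simpa using hi
          have : f i = 0 := le_antisymm (not_lt.1 fun h => hi' ((memS i).2 h)) (hf i)
          simp [f', hi', this]
        rw [Finset.sum_congr rfl h1]
        have h2 : Finset.univ.filter (fun i => i ∈ S) = S := by ext; simp
        rw [h2, Finset.mul_sum, add_right_comm, ← Finset.sum_add_distrib]
        congr 1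
        refine Finset.sum_congr rfl fun i hi => ?_
        simp only [f', hi, if_true]
        ring
      have hright : ∑ i, ∑ j, A i j * max (f i - f j) 0
          = ∑ i, ∑ j, A i j * max (f' i - f' j) 0 + f k * ∑ i ∈ S, ∑ j ∈ Sᶜ, A i j := by
        have h3 : ∑ i ∈ S, ∑ j ∈ Sᶜ, A i j
            = ∑ i, ∑ j, if i ∈ S ∧ j ∉ S then A i j else 0 := by
          rw [← Finset.sum_filter_add_sum_filter_not Finset.univ (fun i => i ∈ S)
            (fun i => ∑ j, if i ∈ S ∧ j ∉ S then A i j else 0)]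
          have h2 : Finset.univ.filter (fun i => i ∈ S) = S := by ext; simp
          have h4 : ∑ i with ¬ i ∈ S, ∑ j, (if i ∈ S ∧ j ∉ S then A i j else 0) = 0 := by
            refine Finset.sum_eq_zero fun i hi => Finset.sum_eq_zero fun j _ => ?_
            have hi' : i ∉ S := by simpa using hi
            simp [hi']
          rw [h4, add_zero, h2]
          refine Finset.sum_congr rfl fun i hi => ?_
          simp only [hi, true_and]
          rw [← Finset.sum_filter]
          congr 1
          ext j
          simp
        rw [h3, Finset.mul_sum, ← Finset.sum_add_distrib]
        refine Finset.sum_congr rfl fun i _ => ?_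
        rw [Finset.mul_sum, ← Finset.sum_add_distrib]
        refine Finset.sum_congr rfl fun j _ => ?_
        have hz : ∀ l, l ∉ S → f l = 0 := fun l hl =>
          le_antisymm (not_lt.1 fun h => hl ((memS l).2 h)) (hf l)
        by_cases hi : i ∈ S <;> by_cases hj : j ∈ S
        · simp [f', hi, hj]
        · have h5 := hkmin i hi
          simp only [f', hi, hj, hz j hj, if_true, if_false, not_false_eq_true, and_self, sub_zero]
          rw [max_eq_left (hf i), max_eq_left (by linarith)]
          ring
        · have h5 := hkmin j hj
          simp only [f', hi, hj, hz i hi, if_true, if_false, false_and, mul_zero, add_zero]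
          rw [max_eq_right (by linarith [hf j]), max_eq_right (by linarith)]
        · simp [f', hi, hj, hz i hi, hz j hj]
      have hc := mul_le_mul_of_nonneg_left (hcut S hsupp) hk.le
      rw [hleft, hright]
      nlinarith

/-- Every function on a finite probability space has a median. -/
theorem exists_median [Nonempty ι] (hp : ∀ i, 0 ≤ p i) (hsum : ∑ i, p i = 1) (g : ι → ℝ) :
    ∃ m, ∑ i with m < g i, p i ≤ 1 / 2 ∧ ∑ i with g i < m, p i ≤ 1 / 2 := by
  -- The median is the least value of `g` with at most half of the mass strictly above it.
  let T := Finset.univ.filter fun k => ∑ i with g k < g i, p i ≤ 1 / 2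
  have hT : T.Nonempty := by
    obtain ⟨k, -, hk⟩ := Finset.univ.exists_max_image g (Finset.univ_nonempty (α := ι))
    refine ⟨k, by
      simp only [T, Finset.mem_filter, Finset.mem_univ, true_and]
      rw [Finset.filter_false_of_mem fun i _ => not_lt.2 (hk i (Finset.mem_univ i))]
      norm_num⟩
  obtain ⟨k, hkT, hk⟩ := T.exists_min_image g hT
  refine ⟨g k, by simpa [T] using hkT, ?_⟩
  rcases (Finset.univ.filter fun i => g i < g k).eq_empty_or_nonempty with h0 | hne
  · rw [h0]; norm_num
  · obtain ⟨l, hl, hlmax⟩ := Finset.exists_max_image _ g hne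
    have hlk : g l < g k := by simpa using hl
    have hlT : l ∉ T := fun h => absurd (hk l h) (not_le.2 hlk)
    have h1 : 1 / 2 < ∑ i with g l < g i, p i := by simpa [T] using hlT
    have h2 : ∑ i with g i < g k, p i ≤ ∑ i with ¬ g l < g i, p i := by
      refine Finset.sum_le_sum_of_subset_of_nonneg ?_ fun i _ _ => hp i
      intro i hi
      simpa using hlmax i hi
    have h3 := Finset.sum_filter_add_sum_filter_not Finset.univ (fun i => g l < g i) p
    linarith

/-- Cheeger's inequality for a nonnegative weight `A` both of whose marginals are `p`. -/
theorem cheeger_inequality [DecidableEq ι] [Nonempty ι] (hA : ∀ i j, 0 ≤ A i j)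
    (hrow : ∀ i, ∑ j, A i j = p i) (hcol : ∀ j, ∑ i, A i j = p j) (hsum : ∑ i, p i = 1)
    (hφ : 0 ≤ φ)
    (hcut : ∀ S : Finset ι, ∑ i ∈ S, p i ≤ 1 / 2 →
      φ * ∑ i ∈ S, p i ≤ ∑ i ∈ S, ∑ j ∈ Sᶜ, A i j)
    (g : ι → ℝ) (hg : ∑ i, p i * g i = 0) :
    φ ^ 2 * ∑ i, p i * g i ^ 2 ≤ 4 * ∑ i, ∑ j, A i j * (g i - g j) ^ 2 := by
  have hp : ∀ i, 0 ≤ p i := fun i => hrow i ▸ Finset.sum_nonneg fun j _ => hA i j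
  obtain ⟨m, hm1, hm2⟩ := exists_median hp hsum g
  set a : ι → ℝ := fun i => g i - m with ha
  set V := ∑ i, p i * a i ^ 2 with hV
  set D := ∑ i, ∑ j, A i j * (g i - g j) ^ 2 with hD
  -- As `g` has mean zero, moving the centre to `m` adds `m ^ 2` to the second moment.
  have hVg : ∑ i, p i * g i ^ 2 ≤ V := by
    have : V = ∑ i, p i * g i ^ 2 - 2 * m * ∑ i, p i * g i + m ^ 2 * ∑ i, p i := by
      rw [hV, Finset.mul_sum, Finset.mul_sum, ← Finset.sum_sub_distrib, ← Finset.sum_add_distrib]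
      exact Finset.sum_congr rfl fun i _ => by simp only [ha]; ring
    rw [this, hg, hsum]
    nlinarith [sq_nonneg m]
  have hV0 : 0 ≤ V := Finset.sum_nonneg fun i _ => mul_nonneg (hp i) (sq_nonneg _)
  have hD0 : 0 ≤ D := Finset.sum_nonneg fun i _ => Finset.sum_nonneg fun j _ =>
    mul_nonneg (hA i j) (sq_nonneg _)
  have h1 := mul_sum_le_sum_posPart_sub hcut hp (fun i => max (a i) 0 ^ 2) (fun i => sq_nonneg _)
    (by
      convert hm1 using 2
      ext i
      simp only [Finset.mem_filter, Finset.mem_univ, true_and]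
      constructor
      · intro h
        by_contra hc
        rw [max_eq_right (by simp only [ha]; linarith)] at h
        norm_num at h
      · intro h
        have : 0 < max (a i) 0 := lt_max_of_lt_left (by simp only [ha]; linarith)
        positivity)
  have h2 := mul_sum_le_sum_posPart_sub hcut hp (fun i => max (-a i) 0 ^ 2) (fun i => sq_nonneg _)
    (by
      convert hm2 using 2
      ext i
      simp only [Finset.mem_filter, Finset.mem_univ, true_and]
      constructor
      · intro h
        by_contra hc
        rw [max_eq_right (by simp only [ha]; linarith)] at h
        norm_num at h
      · intro h
        have : 0 < max (-a i) 0 := lt_max_of_lt_left (by simp only [ha]; linarith)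
        positivity)
  -- The squares of the positive and negative parts of `a` are each supported on at most half of the
  -- mass, by the choice of the median. When the signs differ, `x² + y² ≤ (x - y)²` bounds the
  -- combined variation.
  have h3 : φ * V ≤ ∑ i, ∑ j, A i j * (|a i - a j| * (|a i| + |a j|)) := by
    have e1 : φ * V = φ * ∑ i, p i * max (a i) 0 ^ 2 + φ * ∑ i, p i * max (-a i) 0 ^ 2 := by
      rw [← mul_add, ← Finset.sum_add_distrib, hV]
      congr 1
      refine Finset.sum_congr rfl fun i _ => ?_
      rcases le_total 0 (a i) with h | h
      · rw [max_eq_left h, max_eq_right (by linarith)]; ring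
      · rw [max_eq_right h, max_eq_left (by linarith)]; ring
    rw [e1]
    refine (add_le_add h1 h2).trans ?_
    rw [← Finset.sum_add_distrib]
    refine Finset.sum_le_sum fun i _ => ?_
    rw [← Finset.sum_add_distrib]
    refine Finset.sum_le_sum fun j _ => ?_
    rw [← mul_add]
    refine mul_le_mul_of_nonneg_left ?_ (hA i j)
    generalize a i = x
    generalize a j = y
    have hxy : |x ^ 2 - y ^ 2| ≤ |x - y| * (|x| + |y|) := by
      rw [sq_sub_sq, abs_mul, mul_comm]
      exact mul_le_mul_of_nonneg_left (abs_add_le x y) (abs_nonneg _)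
    rcases le_total 0 x with hx | hx <;> rcases le_total 0 y with hy | hy
    · rw [max_eq_left hx, max_eq_left hy, max_eq_right (by linarith : -x ≤ 0),
        max_eq_right (by linarith : -y ≤ 0)]
      simp only [sub_self, max_self, add_zero]
      exact (max_le (le_abs_self _) (abs_nonneg _)).trans hxy
    · rw [max_eq_left hx, max_eq_right hy, max_eq_right (by linarith : -x ≤ 0),
        max_eq_left (by linarith : 0 ≤ -y), max_eq_left (by nlinarith), max_eq_right (by nlinarith),
        abs_of_nonneg hx, abs_of_nonpos hy, abs_of_nonneg (by linarith)]
      nlinarith [mul_nonneg hx (neg_nonneg.2 hy)]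
    · rw [max_eq_right hx, max_eq_left hy, max_eq_left (by linarith : 0 ≤ -x),
        max_eq_right (by linarith : -y ≤ 0), max_eq_right (by nlinarith), max_eq_left (by nlinarith),
        abs_of_nonpos hx, abs_of_nonneg hy, abs_of_nonpos (by linarith)]
      nlinarith [mul_nonneg hy (neg_nonneg.2 hx)]
    · rw [max_eq_right hx, max_eq_right hy, max_eq_left (by linarith : 0 ≤ -x),
        max_eq_left (by linarith : 0 ≤ -y)]
      simp only [sub_self, max_self, zero_add, neg_sq]
      exact (max_le (le_abs_self _) (abs_nonneg _)).trans hxy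
  -- Cauchy–Schwarz over pairs; the factor `4 * V` comes from `(|x| + |y|)² ≤ 2x² + 2y²` and the two
  -- marginals.
  have h4 : (∑ i, ∑ j, A i j * (|a i - a j| * (|a i| + |a j|))) ^ 2 ≤ D * (4 * V) := by
    have hcs := Finset.sum_mul_sq_le_sq_mul_sq (Finset.univ : Finset (ι × ι))
      (fun q => √(A q.1 q.2) * |a q.1 - a q.2|) (fun q => √(A q.1 q.2) * (|a q.1| + |a q.2|))
    have e1 : ∑ q : ι × ι, (√(A q.1 q.2) * |a q.1 - a q.2|) * (√(A q.1 q.2) * (|a q.1| + |a q.2|))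
        = ∑ i, ∑ j, A i j * (|a i - a j| * (|a i| + |a j|)) := by
      rw [Fintype.sum_prod_type]
      refine Finset.sum_congr rfl fun i _ => Finset.sum_congr rfl fun j _ => ?_
      linear_combination (|a i - a j| * (|a i| + |a j|)) * Real.mul_self_sqrt (hA i j)
    have e2 : ∑ q : ι × ι, (√(A q.1 q.2) * |a q.1 - a q.2|) ^ 2 = D := by
      rw [Fintype.sum_prod_type]
      refine Finset.sum_congr rfl fun i _ => Finset.sum_congr rfl fun j _ => ?_
      rw [mul_pow, Real.sq_sqrt (hA i j), sq_abs]
      simp only [ha]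
      ring
    have e3 : ∑ q : ι × ι, (√(A q.1 q.2) * (|a q.1| + |a q.2|)) ^ 2 ≤ 4 * V := by
      rw [Fintype.sum_prod_type]
      have : 4 * V = ∑ i, ∑ j, A i j * (2 * a i ^ 2 + 2 * a j ^ 2) := by
        simp only [mul_add, Finset.sum_add_distrib]
        rw [Finset.sum_comm (f := fun i j => A i j * (2 * a j ^ 2))]
        simp only [← Finset.sum_mul, hrow, hcol, hV]
        rw [← Finset.sum_add_distrib, Finset.mul_sum]
        exact Finset.sum_congr rfl fun i _ => by ring
      rw [this]
      refine Finset.sum_le_sum fun i _ => Finset.sum_le_sum fun j _ => ?_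
      rw [mul_pow, Real.sq_sqrt (hA i j)]
      refine mul_le_mul_of_nonneg_left ?_ (hA i j)
      nlinarith [sq_nonneg (|a i| - |a j|), sq_abs (a i), sq_abs (a j)]
    rw [e1, e2] at hcs
    exact hcs.trans (mul_le_mul_of_nonneg_left e3 hD0)
  have h5 : (φ * V) ^ 2 ≤ D * (4 * V) :=
    (pow_le_pow_left₀ (mul_nonneg hφ hV0) h3 2).trans h4
  have h6 : φ ^ 2 * V ≤ 4 * D := by
    rcases hV0.eq_or_lt with h | h
    · rw [← h]; linarith
    · refine le_of_mul_le_mul_right ?_ h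
      linarith
  exact (mul_le_mul_of_nonneg_left hVg (sq_nonneg φ)).trans h6

end Cheeger

end NonnegMatrix

namespace NonnegMatrix

/-! ### The semigroup `exp (t L)`: derivatives, invariants, positivity. -/

section Semigroup

variable {n : ℕ} {R L : Matrix (Fin n) (Fin n) ℝ}

/-- The exponential depends only on the topology; the operator norm is an auxiliary choice, made
locally for differentiation. -/
theorem hasDerivAt_exp_smul (L : Matrix (Fin n) (Fin n) ℝ) (t : ℝ) :
    letI : NormedRing (Matrix (Fin n) (Fin n) ℝ) := Matrix.linftyOpNormedRing
    letI : NormedAlgebra ℝ (Matrix (Fin n) (Fin n) ℝ) := Matrix.linftyOpNormedAlgebra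
    HasDerivAt (fun s : ℝ => NormedSpace.exp (s • L)) (L * NormedSpace.exp (t • L)) t := by
  let _ : NormedRing (Matrix (Fin n) (Fin n) ℝ) := Matrix.linftyOpNormedRing
  let _ : NormedAlgebra ℝ (Matrix (Fin n) (Fin n) ℝ) := Matrix.linftyOpNormedAlgebra
  exact hasDerivAt_exp_smul_const' (𝕂 := ℝ) L t

/-- Reading off one coordinate gives a scalar derivative that no longer refers to a matrix norm. -/
theorem hasDerivAt_exp_smul_mulVec (L : Matrix (Fin n) (Fin n) ℝ) (x : Fin n → ℝ) (i : Fin n)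
    (t : ℝ) :
    HasDerivAt (fun s : ℝ => (NormedSpace.exp (s • L) *ᵥ x) i)
      ((L *ᵥ (NormedSpace.exp (t • L) *ᵥ x)) i) t := by
  let _ : NormedRing (Matrix (Fin n) (Fin n) ℝ) := Matrix.linftyOpNormedRing
  let _ : NormedAlgebra ℝ (Matrix (Fin n) (Fin n) ℝ) := Matrix.linftyOpNormedAlgebra
  let ev : Matrix (Fin n) (Fin n) ℝ →ₗ[ℝ] ℝ :=
    { toFun := fun M => (M *ᵥ x) i
      map_add' := fun M N => by simp [Matrix.add_mulVec]
      map_smul' := fun c M => by simp [Matrix.smul_mulVec] }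
  have h := (LinearMap.toContinuousLinearMap ev).hasFDerivAt.comp_hasDerivAt t
    (hasDerivAt_exp_smul L t)
  rw [Matrix.mulVec_mulVec]
  exact h

theorem exp_smul_commute (L : Matrix (Fin n) (Fin n) ℝ) (t : ℝ) :
    L * NormedSpace.exp (t • L) = NormedSpace.exp (t • L) * L := by
  let _ : NormedRing (Matrix (Fin n) (Fin n) ℝ) := Matrix.linftyOpNormedRing
  let _ : NormedAlgebra ℝ (Matrix (Fin n) (Fin n) ℝ) := Matrix.linftyOpNormedAlgebra
  exact ((Commute.refl L).smul_right t).exp_right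

theorem exp_smul_mulVec_of_mulVec_eq_zero {v : Fin n → ℝ} (hv : L *ᵥ v = 0) (t : ℝ) :
    NormedSpace.exp (t • L) *ᵥ v = v := by
  ext i
  have h : ∀ s, HasDerivAt (fun s : ℝ => (NormedSpace.exp (s • L) *ᵥ v) i) 0 s := fun s => by
    convert hasDerivAt_exp_smul_mulVec L v i s using 1
    rw [Matrix.mulVec_mulVec, exp_smul_commute, ← Matrix.mulVec_mulVec, hv]
    simp
  have := is_const_of_deriv_eq_zero (fun s => (h s).differentiableAt) (fun s => (h s).deriv) t 0
  simpa using this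

theorem dotProduct_exp_smul_mulVec {u : Fin n → ℝ} (hu : u ᵥ* L = 0) (x : Fin n → ℝ) (t : ℝ) :
    u ⬝ᵥ (NormedSpace.exp (t • L) *ᵥ x) = u ⬝ᵥ x := by
  have h : ∀ s, HasDerivAt (fun s : ℝ => u ⬝ᵥ (NormedSpace.exp (s • L) *ᵥ x)) 0 s := fun s => by
    have h1 : HasDerivAt (fun s : ℝ => u ⬝ᵥ (NormedSpace.exp (s • L) *ᵥ x))
        (u ⬝ᵥ (L *ᵥ (NormedSpace.exp (s • L) *ᵥ x))) s :=
      HasDerivAt.fun_sum fun i _ => (hasDerivAt_exp_smul_mulVec L x i s).const_mul (u i)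
    rwa [Matrix.dotProduct_mulVec, hu, zero_dotProduct] at h1
  have := is_const_of_deriv_eq_zero (fun s => (h s).differentiableAt) (fun s => (h s).deriv) t 0
  simpa using this

theorem exp_nonneg {M : Matrix (Fin n) (Fin n) ℝ} (hM : ∀ i j, 0 ≤ M i j) (i j : Fin n) :
    0 ≤ NormedSpace.exp M i j := by
  let _ : NormedRing (Matrix (Fin n) (Fin n) ℝ) := Matrix.linftyOpNormedRing
  let _ : NormedAlgebra ℝ (Matrix (Fin n) (Fin n) ℝ) := Matrix.linftyOpNormedAlgebra
  have hpow : ∀ k : ℕ, ∀ i j, 0 ≤ (M ^ k) i j := fun k => by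
    induction k with
    | zero => intro i j; rw [pow_zero, Matrix.one_apply]; split_ifs <;> norm_num
    | succ k ih =>
      intro i j
      rw [pow_succ, Matrix.mul_apply]
      exact Finset.sum_nonneg fun l _ => mul_nonneg (ih i l) (hM l j)
  have h := NormedSpace.exp_series_hasSum_exp' (𝕂 := ℝ) M
  have h' : HasSum (fun k : ℕ => ((k.factorial : ℝ)⁻¹ • M ^ k) i j) (NormedSpace.exp M i j) :=
    h.map (Matrix.entryAddMonoidHom ℝ i j) (continuous_id.matrix_elem i j)
  refine h'.nonneg fun k => ?_
  rw [Matrix.smul_apply]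
  exact mul_nonneg (by positivity) (hpow k i j)

/-- Since `1` is central, the exponential factors as `exp (t R)` times the positive scalar `e^{-t}`.
-/
theorem exp_smul_sub_one_nonneg (hR : ∀ i j, 0 ≤ R i j) {t : ℝ} (ht : 0 ≤ t) (i j : Fin n) :
    0 ≤ NormedSpace.exp (t • (R - 1)) i j := by
  have h1 : t • (R - 1) = t • R + Matrix.diagonal (fun _ => -t) := by
    ext a b
    by_cases hab : a = b
    · subst hab; simp; ring
    · simp [hab]
  have hc : Commute (t • R) (Matrix.diagonal (fun _ : Fin n => -t)) := by
    have : Matrix.diagonal (fun _ : Fin n => -t) = Matrix.scalar (Fin n) (-t) := rfl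
    rw [this]
    exact (Matrix.scalar_commute _ (fun r => Commute.all _ _) _).symm
  rw [h1, Matrix.exp_add_of_commute _ _ hc, Matrix.exp_diagonal, Matrix.mul_diagonal]
  refine mul_nonneg (exp_nonneg (fun a b => mul_nonneg ht (hR a b)) i j) ?_
  rw [Pi.coe_exp, ← Real.exp_eq_exp_ℝ]
  exact (Real.exp_pos _).le

theorem exp_pow_eq_exp_smul (L : Matrix (Fin n) (Fin n) ℝ) (k : ℕ) :
    NormedSpace.exp L ^ k = NormedSpace.exp ((k : ℝ) • L) := by
  rw [← Matrix.exp_nsmul, Nat.cast_smul_eq_nsmul]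

theorem continuous_exp_smul_mulVec (L : Matrix (Fin n) (Fin n) ℝ) (x : Fin n → ℝ) :
    Continuous fun s : ℝ => NormedSpace.exp (s • L) *ᵥ x :=
  continuous_pi fun i => continuous_iff_continuousAt.2 fun t =>
    (hasDerivAt_exp_smul_mulVec L x i t).continuousAt

end Semigroup

variable {n : ℕ} {R P : Matrix (Fin n) (Fin n) ℝ} {u v : Fin n → ℝ} {ε : ℝ}

theorem weightedL1_eq (hu : ∀ i, 0 < u i) (x : Fin n → ℝ) :
    weightedL1 u x = ∑ i, u i * |x i| := by
  refine Finset.sum_congr rfl fun i _ => ?_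
  rw [Matrix.mulVec_diagonal, abs_mul, abs_of_pos (hu i)]

theorem sub_vecMulVec_mulVec (x : Fin n → ℝ) (i : Fin n) :
    ((P - Matrix.vecMulVec v u) *ᵥ x) i = (P *ᵥ x) i - v i * (u ⬝ᵥ x) := by
  rw [Matrix.sub_mulVec, Pi.sub_apply, Matrix.vecMulVec_mulVec]
  simp

/-- Each test vector `x` imposes a closed condition on `t`. Closedness is what lets the infimum be
attained. -/
theorem isClosed_mixedTimes : IsClosed (mixedTimes R u v ε) := by
  have : mixedTimes R u v ε = Set.Ici 0 ∩ ⋂ x : Fin n → ℝ, ⋂ _ : weightedL1 u x = 1,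
      {t : ℝ | weightedL1 u ((NormedSpace.exp (t • (R - 1)) - Matrix.vecMulVec v u) *ᵥ x) ≤ ε} := by
    ext t
    simp [mixedTimes, IsMixed]
  rw [this]
  refine isClosed_Ici.inter (isClosed_iInter fun x => isClosed_iInter fun _ =>
    isClosed_le ?_ continuous_const)
  simp only [weightedL1, Matrix.sub_mulVec, Matrix.mulVec_diagonal, Pi.sub_apply]
  refine continuous_finsetSum _ fun i _ => (continuous_const.mul (Continuous.sub ?_
    continuous_const)).abs
  exact (continuous_apply i).comp (continuous_exp_smul_mulVec _ x)

theorem mem_mixedSteps_exp_iff (k : ℕ) :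
    k ∈ mixedSteps (NormedSpace.exp (R - 1)) u v ε ↔ (k : ℝ) ∈ mixedTimes R u v ε := by
  simp [mixedSteps, mixedTimes, exp_pow_eq_exp_smul]

/-! ### Stationary mass, cuts and expansion. -/

namespace IsPFPair

theorem sub_one_mulVec (hR : IsPFPair R u v) : (R - 1) *ᵥ v = 0 := by
  rw [Matrix.sub_mulVec, hR.right_eigen, Matrix.one_mulVec, sub_self]

theorem vecMul_sub_one (hR : IsPFPair R u v) : u ᵥ* (R - 1) = 0 := by
  rw [Matrix.vecMul_sub, hR.left_eigen, Matrix.vecMul_one, sub_self]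

theorem weight_nonneg (hR : IsPFPair R u v) (i j : Fin n) : 0 ≤ u i * R i j * v j :=
  mul_nonneg (mul_nonneg (hR.left_pos i).le (hR.nonneg i j)) (hR.right_pos j).le

theorem sum_row (hR : IsPFPair R u v) (i : Fin n) : ∑ j, u i * R i j * v j = u i * v i := by
  have := congrFun hR.right_eigen i
  simp only [Matrix.mulVec, dotProduct] at this
  simp only [mul_assoc, ← Finset.mul_sum, this]

theorem sum_col (hR : IsPFPair R u v) (j : Fin n) : ∑ i, u i * R i j * v j = u j * v j := by
  have := congrFun hR.left_eigen j
  simp only [Matrix.vecMul, dotProduct] at this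
  simp only [← Finset.sum_mul, this]

theorem sum_mass (hR : IsPFPair R u v) : ∑ i, u i * v i = 1 := hR.normalized

theorem flow_univ (hR : IsPFPair R u v) (S : Finset (Fin n)) :
    flow R u v S Finset.univ = ∑ i ∈ S, u i * v i :=
  Finset.sum_congr rfl fun i _ => hR.sum_row i

/-- Row and column sums over `S` both give the mass of `S`; removing the internal flow leaves equal
outflow and inflow. -/
theorem flow_compl_comm (hR : IsPFPair R u v) (S : Finset (Fin n)) :
    flow R u v Sᶜ S = flow R u v S Sᶜ := by
  have h1 : flow R u v S S + flow R u v S Sᶜ = ∑ i ∈ S, u i * v i := by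
    rw [← hR.flow_univ, flow, flow, flow, ← Finset.sum_add_distrib]
    exact Finset.sum_congr rfl fun i _ => Finset.sum_add_sum_compl _ _
  have h2 : flow R u v S S + flow R u v Sᶜ S = ∑ j ∈ S, u j * v j := by
    rw [flow, flow, Finset.sum_add_sum_compl, Finset.sum_comm]
    exact Finset.sum_congr rfl fun j _ => hR.sum_col j
  linarith

theorem cutExpansion_compl (hR : IsPFPair R u v) (S : Finset (Fin n)) :
    cutExpansion R u v Sᶜ = cutExpansion R u v S := by
  rw [cutExpansion, cutExpansion, compl_compl, hR.flow_compl_comm, min_comm]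

theorem sum_mass_compl (hR : IsPFPair R u v) (S : Finset (Fin n)) :
    ∑ i ∈ Sᶜ, u i * v i = 1 - ∑ i ∈ S, u i * v i := by
  rw [← hR.sum_mass, ← Finset.sum_add_sum_compl S]
  ring

theorem cutExpansion_eq (hR : IsPFPair R u v) {S : Finset (Fin n)}
    (hS : ∑ i ∈ S, u i * v i ≤ 1 / 2) :
    cutExpansion R u v S = flow R u v S Sᶜ / ∑ i ∈ S, u i * v i := by
  rw [cutExpansion, hR.flow_univ, hR.flow_univ, hR.sum_mass_compl, min_eq_left (by linarith)]

theorem sum_mass_pos (hR : IsPFPair R u v) {S : Finset (Fin n)} (hS : S.Nonempty) :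
    0 < ∑ i ∈ S, u i * v i :=
  Finset.sum_pos (fun i _ => mul_pos (hR.left_pos i) (hR.right_pos i)) hS

theorem edgeExpansion_mul_le_flow (hR : IsPFPair R u v) {S : Finset (Fin n)}
    (hS : ∑ i ∈ S, u i * v i ≤ 1 / 2) :
    edgeExpansion R u v * ∑ i ∈ S, u i * v i ≤ flow R u v S Sᶜ := by
  rcases S.eq_empty_or_nonempty with rfl | hne
  · simp [flow]
  · have hc : Sᶜ.Nonempty := by
      rw [Finset.nonempty_iff_ne_empty]
      intro h
      have := hR.sum_mass_compl S
      rw [h, Finset.sum_empty] at this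
      linarith
    have h : edgeExpansion R u v ≤ cutExpansion R u v S :=
      ciInf_le (Set.finite_range _).bddBelow
        (⟨S, hne, hc⟩ : {S : Finset (Fin n) // S.Nonempty ∧ Sᶜ.Nonempty})
    rwa [hR.cutExpansion_eq hS, le_div_iff₀ (hR.sum_mass_pos hne)] at h

/-- The minimum is over a finite family, nonempty because `2 ≤ n`, and expansion is invariant under
complement, so the lighter side may be taken. -/
theorem exists_cut (hR : IsPFPair R u v) (hn : 2 ≤ n) :
    ∃ S : Finset (Fin n), S.Nonempty ∧ ∑ i ∈ S, u i * v i ≤ 1 / 2 ∧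
      flow R u v S Sᶜ = edgeExpansion R u v * ∑ i ∈ S, u i * v i := by
  have : Nonempty {S : Finset (Fin n) // S.Nonempty ∧ Sᶜ.Nonempty} :=
    ⟨⟨{⟨0, by omega⟩}, Finset.singleton_nonempty _, ⟨⟨1, by omega⟩, by
      simp [Fin.ext_iff]⟩⟩⟩
  obtain ⟨⟨S, hS, hSc⟩, h⟩ := exists_eq_ciInf_of_finite
    (f := fun S : {S : Finset (Fin n) // S.Nonempty ∧ Sᶜ.Nonempty} => cutExpansion R u v S)
  change cutExpansion R u v S = edgeExpansion R u v at h
  rcases le_total (∑ i ∈ S, u i * v i) (1 / 2) with hle | hle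
  · refine ⟨S, hS, hle, ?_⟩
    rw [← h, hR.cutExpansion_eq hle, div_mul_cancel₀ _ (hR.sum_mass_pos hS).ne']
  · have hle' : ∑ i ∈ Sᶜ, u i * v i ≤ 1 / 2 := by rw [hR.sum_mass_compl]; linarith
    refine ⟨Sᶜ, hSc, hle', ?_⟩
    rw [← h, ← hR.cutExpansion_compl, hR.cutExpansion_eq hle',
      div_mul_cancel₀ _ (hR.sum_mass_pos hSc).ne']

theorem edgeExpansion_le_one (hR : IsPFPair R u v) (hn : 2 ≤ n) : edgeExpansion R u v ≤ 1 := by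
  obtain ⟨S, hS, -, h⟩ := hR.exists_cut hn
  have h1 : flow R u v S Sᶜ ≤ ∑ i ∈ S, u i * v i := by
    rw [← hR.flow_univ]
    exact Finset.sum_le_sum fun i _ => Finset.sum_le_sum_of_subset_of_nonneg
      (Finset.subset_univ _) fun j _ _ => hR.weight_nonneg i j
  have := hR.sum_mass_pos hS
  rw [h] at h1
  by_contra hc
  nlinarith

theorem kappa_le (i : Fin n) : kappa u v ≤ u i * v i := ciInf_le (Set.finite_range _).bddBelow i

theorem kappa_pos (hR : IsPFPair R u v) (hn : 2 ≤ n) : 0 < kappa u v := by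
  have : Nonempty (Fin n) := ⟨⟨0, by omega⟩⟩
  obtain ⟨i, hi⟩ := exists_eq_ciInf_of_finite (f := fun i => u i * v i)
  rw [kappa, ← hi]
  exact mul_pos (hR.left_pos i) (hR.right_pos i)

theorem card_mul_kappa_le (hR : IsPFPair R u v) : n * kappa u v ≤ 1 := by
  rw [← hR.sum_mass]
  have := Finset.card_nsmul_le_sum Finset.univ (fun i => u i * v i) (kappa u v)
    fun i _ => kappa_le i
  simpa using this

end IsPFPair

end NonnegMatrix

/-! ### Energy decay and the upper bound. -/

namespace NonnegMatrix

namespace IsPFPair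

variable {n : ℕ} {R : Matrix (Fin n) (Fin n) ℝ} {u v : Fin n → ℝ} {ε : ℝ}

theorem hasDerivAt_energy (hR : IsPFPair R u v) (w : Fin n → ℝ) (t : ℝ) :
    HasDerivAt (fun s : ℝ => ∑ i, u i / v i * (NormedSpace.exp (s • (R - 1)) *ᵥ w) i ^ 2)
      (-∑ i, ∑ j, u i * R i j * v j *
        ((NormedSpace.exp (t • (R - 1)) *ᵥ w) i / v i -
          (NormedSpace.exp (t • (R - 1)) *ᵥ w) j / v j) ^ 2) t := by
  have h := HasDerivAt.fun_sum (u := Finset.univ) fun i _ =>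
    ((hasDerivAt_exp_smul_mulVec (R - 1) w i t).fun_pow 2).const_mul (u i / v i)
  refine h.congr_deriv ?_
  set y := NormedSpace.exp (t • (R - 1)) *ᵥ w
  set g : Fin n → ℝ := fun i => y i / v i with hg
  have hy : ∀ i, y i = v i * g i := fun i => by
    simp only [hg]
    field_simp [(hR.right_pos i).ne']
  have e1 : ∀ i, u i / v i * ((2 : ℕ) * y i ^ (2 - 1) * ((R - 1) *ᵥ y) i)
      = ∑ j, u i * R i j * v j * (2 * g i * g j) - 2 * (u i * v i * g i ^ 2) := fun i => by
    have : ((R - 1) *ᵥ y) i = ∑ j, R i j * (v j * g j) - v i * g i := by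
      rw [Matrix.sub_mulVec, Matrix.one_mulVec, Pi.sub_apply, hy i]
      simp only [Matrix.mulVec, dotProduct, hy]
    rw [this, hy i]
    have h2 : ∑ j, u i * R i j * v j * (2 * g i * g j)
        = 2 * u i * g i * ∑ j, R i j * (v j * g j) := by
      rw [Finset.mul_sum]
      exact Finset.sum_congr rfl fun j _ => by ring
    rw [h2]
    have := (hR.right_pos i).ne'
    field_simp
    push_cast
    ring
  have e2 : ∑ i, ∑ j, u i * R i j * v j * (g i - g j) ^ 2
      = 2 * ∑ i, u i * v i * g i ^ 2 - ∑ i, ∑ j, u i * R i j * v j * (2 * g i * g j) := by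
    have : ∀ i j, u i * R i j * v j * (g i - g j) ^ 2 = u i * R i j * v j * g i ^ 2
        + u i * R i j * v j * g j ^ 2 - u i * R i j * v j * (2 * g i * g j) := fun i j => by ring
    simp only [this, Finset.sum_sub_distrib, Finset.sum_add_distrib]
    rw [Finset.sum_comm (f := fun i j => u i * R i j * v j * g j ^ 2)]
    simp only [← Finset.sum_mul, hR.sum_row, hR.sum_col]
    ring
  rw [Finset.sum_congr rfl fun i _ => e1 i, Finset.sum_sub_distrib, ← Finset.mul_sum]
  change _ = -∑ i, ∑ j, u i * R i j * v j * (g i - g j) ^ 2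
  rw [e2]
  ring

/-- The energy of a vector orthogonal to `u` decays exponentially along the semigroup. -/
theorem energy_le (hR : IsPFPair R u v) (hn : 2 ≤ n) (hφ : 0 ≤ edgeExpansion R u v)
    {w : Fin n → ℝ} (hw : u ⬝ᵥ w = 0) {t : ℝ} (ht : 0 ≤ t) :
    ∑ i, u i / v i * (NormedSpace.exp (t • (R - 1)) *ᵥ w) i ^ 2
      ≤ Real.exp (-(edgeExpansion R u v ^ 2 / 4 * t)) * ∑ i, u i / v i * w i ^ 2 := by
  have : Nonempty (Fin n) := ⟨⟨0, by omega⟩⟩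
  set c := edgeExpansion R u v ^ 2 / 4 with hc
  set E : ℝ → ℝ := fun s => ∑ i, u i / v i * (NormedSpace.exp (s • (R - 1)) *ᵥ w) i ^ 2 with hE
  have hd : ∀ s, HasDerivAt (fun s => Real.exp (c * s) * E s)
      (Real.exp (c * s) * (c * 1) * E s + Real.exp (c * s) *
      (-∑ i, ∑ j, u i * R i j * v j *
        ((NormedSpace.exp (s • (R - 1)) *ᵥ w) i / v i -
          (NormedSpace.exp (s • (R - 1)) *ᵥ w) j / v j) ^ 2)) s := fun s =>
    (((hasDerivAt_id s).const_mul c).exp).mul (hR.hasDerivAt_energy w s)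
  -- Grönwall in integrating-factor form.
  have hanti : Antitone fun s => Real.exp (c * s) * E s := by
    refine antitone_of_deriv_nonpos (fun s => (hd s).differentiableAt) fun s => ?_
    rw [(hd s).deriv]
    set y := NormedSpace.exp (s • (R - 1)) *ᵥ w with hy
    have hmean : ∑ i, u i * v i * (y i / v i) = 0 := by
      rw [← hw, ← dotProduct_exp_smul_mulVec hR.vecMul_sub_one w s]
      refine Finset.sum_congr rfl fun i _ => ?_
      have := (hR.right_pos i).ne'
      field_simp
      rfl
    have h := cheeger_inequality hR.weight_nonneg hR.sum_row hR.sum_col hR.sum_mass hφ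
      (fun S hS => hR.edgeExpansion_mul_le_flow hS) (fun i => y i / v i) hmean
    have hEs : ∑ i, u i * v i * (y i / v i) ^ 2 = E s := by
      refine Finset.sum_congr rfl fun i _ => ?_
      have := (hR.right_pos i).ne'
      field_simp
      rfl
    rw [hEs] at h
    have := Real.exp_pos (c * s)
    have h' : c * E s ≤ ∑ i, ∑ j, u i * R i j * v j * (y i / v i - y j / v j) ^ 2 := by
      rw [hc]; linarith
    nlinarith
  have h := hanti ht
  have h0 : E 0 = ∑ i, u i / v i * w i ^ 2 := by simp [hE]
  simp only [mul_zero, Real.exp_zero, one_mul, h0] at h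
  rw [Real.exp_neg, inv_mul_eq_div, le_div_iff₀ (Real.exp_pos _), mul_comm]
  exact h

/-- Cauchy–Schwarz for `u |w| = √(u v) · √(u / v) |w|`, the first factor having total square `1`. -/
theorem weightedL1_sq_le (hR : IsPFPair R u v) (w : Fin n → ℝ) :
    weightedL1 u w ^ 2 ≤ ∑ i, u i / v i * w i ^ 2 := by
  rw [weightedL1_eq hR.left_pos]
  have h := Finset.sum_sq_le_sum_mul_sum_of_sq_le_mul Finset.univ
    (r := fun i => u i * |w i|) (f := fun i => u i * v i) (g := fun i => u i / v i * w i ^ 2)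
    (fun i _ => (mul_pos (hR.left_pos i) (hR.right_pos i)).le)
    (fun i _ => mul_nonneg (div_pos (hR.left_pos i) (hR.right_pos i)).le (sq_nonneg _))
    (fun i _ => by
      have := (hR.right_pos i).ne'
      rw [mul_pow, sq_abs]
      apply le_of_eq
      field_simp)
  rwa [hR.sum_mass, one_mul] at h

/-- Removing the `v` component is an orthogonal projection for the weight `u / v`, so energy only
drops. Then `(u / v) x² = (u |x|)² / (u v)`, and `ℓ²` is dominated by `ℓ¹`. -/
theorem energy_sub_le (hR : IsPFPair R u v) (hn : 2 ≤ n) {x : Fin n → ℝ}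
    (hx : weightedL1 u x = 1) :
    ∑ i, u i / v i * (x i - v i * (u ⬝ᵥ x)) ^ 2 ≤ 1 / kappa u v := by
  set a := u ⬝ᵥ x with ha
  have h1 : ∑ i, u i / v i * (x i - v i * a) ^ 2 = ∑ i, u i / v i * x i ^ 2 - a ^ 2 := by
    have : ∀ i, u i / v i * (x i - v i * a) ^ 2
        = u i / v i * x i ^ 2 - 2 * a * (u i * x i) + a ^ 2 * (u i * v i) := fun i => by
      have := (hR.right_pos i).ne'
      field_simp
      ring
    simp only [this, Finset.sum_add_distrib, Finset.sum_sub_distrib, ← Finset.mul_sum, hR.sum_mass]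
    rw [show ∑ i, u i * x i = a from rfl]
    ring
  have h2 : ∑ i, u i / v i * x i ^ 2 ≤ 1 / kappa u v * ∑ i, (u i * |x i|) ^ 2 := by
    rw [Finset.mul_sum]
    refine Finset.sum_le_sum fun i _ => ?_
    have hu := hR.left_pos i
    have hv := hR.right_pos i
    have h3 : u i / v i * x i ^ 2 = 1 / (u i * v i) * (u i * |x i|) ^ 2 := by
      rw [mul_pow, sq_abs]
      field_simp
    rw [h3]
    exact mul_le_mul_of_nonneg_right
      (one_div_le_one_div_of_le (hR.kappa_pos hn) (kappa_le i)) (sq_nonneg _)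
  have h4 : ∑ i, (u i * |x i|) ^ 2 ≤ 1 := by
    have := Finset.sum_sq_le_sq_sum_of_nonneg (s := Finset.univ) (f := fun i => u i * |x i|)
      fun i _ => mul_nonneg (hR.left_pos i).le (abs_nonneg _)
    rwa [← weightedL1_eq hR.left_pos, hx, one_pow] at this
  have h5 : 0 ≤ 1 / kappa u v := (one_div_pos.2 (hR.kappa_pos hn)).le
  rw [h1]
  nlinarith [sq_nonneg a]

theorem exp_smul_sub_mulVec (hR : IsPFPair R u v) (x : Fin n → ℝ) (t : ℝ) :
    (NormedSpace.exp (t • (R - 1)) - Matrix.vecMulVec v u) *ᵥ x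
      = NormedSpace.exp (t • (R - 1)) *ᵥ (x - (u ⬝ᵥ x) • v) := by
  ext i
  rw [sub_vecMulVec_mulVec, Matrix.mulVec_sub, Matrix.mulVec_smul,
    exp_smul_mulVec_of_mulVec_eq_zero hR.sub_one_mulVec]
  simp [mul_comm]

theorem isMixed_of_le (hR : IsPFPair R u v) (hn : 2 ≤ n) (hε : 0 < ε)
    (hφ : 0 < edgeExpansion R u v) {t : ℝ} (ht : 0 ≤ t)
    (ht' : 8 * Real.log (n / (kappa u v * ε)) ≤ edgeExpansion R u v ^ 2 * t) :
    IsMixed (NormedSpace.exp (t • (R - 1))) u v ε := by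
  intro x hx
  have hκ := hR.kappa_pos hn
  have hn0 : (2 : ℝ) ≤ n := by exact_mod_cast hn
  rw [hR.exp_smul_sub_mulVec]
  set w := x - (u ⬝ᵥ x) • v with hw
  have hwu : u ⬝ᵥ w = 0 := by
    rw [hw, dotProduct_sub, dotProduct_smul, hR.normalized]
    simp
  have h1 := (hR.weightedL1_sq_le _).trans (hR.energy_le hn hφ.le hwu ht)
  have h2 : ∑ i, u i / v i * w i ^ 2 ≤ 1 / kappa u v := by
    have := hR.energy_sub_le hn hx
    refine le_of_eq_of_le (Finset.sum_congr rfl fun i _ => ?_) this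
    simp [hw, mul_comm]
  have hpos : (0 : ℝ) < n / (kappa u v * ε) := by positivity
  -- The `8` is `4 · 2`: decay rate `φ²/4`, and a square because energy controls the norm squared.
  have h3 : Real.exp (-(edgeExpansion R u v ^ 2 / 4 * t)) ≤ (kappa u v * ε / n) ^ 2 := by
    have : (kappa u v * ε / n) ^ 2 = Real.exp (-(2 * Real.log (n / (kappa u v * ε)))) := by
      rw [Real.exp_neg, two_mul, Real.exp_add, Real.exp_log hpos]
      field_simp
    rw [this, Real.exp_le_exp]
    linarith
  have h4 : (kappa u v * ε / n) ^ 2 * (1 / kappa u v) ≤ ε ^ 2 := by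
    have hk1 : kappa u v ≤ n ^ 2 := by
      have := hR.card_mul_kappa_le
      nlinarith
    have : (kappa u v * ε / n) ^ 2 * (1 / kappa u v) = ε ^ 2 * (kappa u v / n ^ 2) := by
      field_simp
    rw [this]
    exact mul_le_of_le_one_right (sq_nonneg _) ((div_le_one (by positivity)).2 hk1)
  refine le_of_sq_le_sq ?_ hε.le
  exact h1.trans ((mul_le_mul h3 h2 (Finset.sum_nonneg fun i _ =>
    mul_nonneg (div_pos (hR.left_pos i) (hR.right_pos i)).le (sq_nonneg _)) (sq_nonneg _)).trans h4)

/-- Covers large `ε`, where the logarithm may be too small to absorb rounding to an integer time. -/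
theorem zero_mem_mixedTimes (hR : IsPFPair R u v) (hε : 2 ≤ ε) : 0 ∈ mixedTimes R u v ε := by
  refine ⟨le_rfl, fun x hx => le_trans ?_ hε⟩
  have hx' := hx
  rw [weightedL1_eq hR.left_pos] at hx' ⊢
  have ha : |u ⬝ᵥ x| ≤ 1 := by
    rw [← hx']
    refine (Finset.abs_sum_le_sum_abs _ _).trans (Finset.sum_le_sum fun i _ => ?_)
    rw [abs_mul, abs_of_pos (hR.left_pos i)]
  calc _ ≤ ∑ i, (u i * |x i| + u i * v i * |u ⬝ᵥ x|) := by
        refine Finset.sum_le_sum fun i _ => ?_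
        rw [sub_vecMulVec_mulVec, mul_assoc, ← mul_add]
        refine mul_le_mul_of_nonneg_left ?_ (hR.left_pos i).le
        have := abs_sub ((NormedSpace.exp ((0 : ℝ) • (R - 1)) *ᵥ x) i) (v i * (u ⬝ᵥ x))
        rw [abs_mul, abs_of_pos (hR.right_pos i)] at this
        simpa using this
    _ = 1 + |u ⬝ᵥ x| := by
        rw [Finset.sum_add_distrib, hx', ← Finset.sum_mul, hR.sum_mass, one_mul]
    _ ≤ 2 := by linarith

theorem exists_mixedSteps_le (hR : IsPFPair R u v) (hn : 2 ≤ n) (hε : 0 < ε)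
    (hε' : ε ≤ n / kappa u v) (hφ : 0 < edgeExpansion R u v) :
    ∃ k ∈ mixedSteps (NormedSpace.exp (R - 1)) u v ε,
      (k : ℝ) ≤ 100 * Real.log (n / (kappa u v * ε)) / edgeExpansion R u v ^ 2 := by
  have hκ := hR.kappa_pos hn
  have hn0 : (2 : ℝ) ≤ n := by exact_mod_cast hn
  set φ := edgeExpansion R u v with hφd
  set ℓ := Real.log (n / (kappa u v * ε)) with hℓ
  have hℓ0 : 0 ≤ ℓ := by
    refine Real.log_nonneg ((one_le_div (by positivity)).2 ?_)
    rwa [le_div_iff₀ hκ, mul_comm] at hε'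
  rcases le_or_gt 2 ε with h2 | h2
  · refine ⟨0, ?_, by simpa using by positivity⟩
    rw [mem_mixedSteps_exp_iff]
    simpa using hR.zero_mem_mixedTimes h2
  · have hℓ1 : 1 / 2 ≤ ℓ := by
      have h3 : Real.log 2 ≤ ℓ := by
        refine Real.log_le_log two_pos ((le_div_iff₀ (by positivity)).2 ?_)
        have := hR.card_mul_kappa_le
        nlinarith
      linarith [Real.log_two_gt_d9]
    have hφ1 : φ ≤ 1 := hR.edgeExpansion_le_one hn
    have hφ2 : φ ^ 2 ≤ 1 := pow_le_one₀ hφ.le hφ1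
    have hφp : 0 < φ ^ 2 := by positivity
    have hnn : 0 ≤ 100 * ℓ / φ ^ 2 := by positivity
    -- Rounding down costs at most `φ ^ 2 ≤ 1` after multiplying by `φ ^ 2`, and `100 * ℓ - 1 ≥ 8 *
    -- ℓ` because `ℓ ≥ 1 / 2`.
    refine ⟨⌊100 * ℓ / φ ^ 2⌋₊, ?_, Nat.floor_le hnn⟩
    rw [mem_mixedSteps_exp_iff]
    refine ⟨Nat.cast_nonneg _, hR.isMixed_of_le hn hε hφ (Nat.cast_nonneg _) ?_⟩
    have h4 := (Nat.lt_floor_add_one (100 * ℓ / φ ^ 2)).le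
    rw [div_le_iff₀ hφp] at h4
    change 8 * ℓ ≤ φ ^ 2 * _
    nlinarith

/-! ### Escape from a cut and the lower bound. -/

/-- The mass that leaves a cut `S` up to time `t` is at most `t` times the expansion of `S`. -/
theorem sum_compl_exp_smul_mulVec_le (hR : IsPFPair R u v) (S : Finset (Fin n)) {t : ℝ}
    (ht : 0 ≤ t) :
    ∑ i ∈ Sᶜ, u i * (NormedSpace.exp (t • (R - 1)) *ᵥ fun i => if i ∈ S then v i else 0) i
      ≤ t * flow R u v S Sᶜ := by
  set x : Fin n → ℝ := fun i => if i ∈ S then v i else 0 with hx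
  have hd : ∀ s, HasDerivAt
      (fun s : ℝ => s * flow R u v S Sᶜ
        - ∑ i ∈ Sᶜ, u i * (NormedSpace.exp (s • (R - 1)) *ᵥ x) i)
      (1 * flow R u v S Sᶜ
        - ∑ i ∈ Sᶜ, u i * ((R - 1) *ᵥ (NormedSpace.exp (s • (R - 1)) *ᵥ x)) i) s := fun s =>
    ((hasDerivAt_id s).mul_const _).sub
      (HasDerivAt.fun_sum fun i _ => (hasDerivAt_exp_smul_mulVec (R - 1) x i s).const_mul (u i))
  have hmono : MonotoneOn (fun s : ℝ => s * flow R u v S Sᶜ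
        - ∑ i ∈ Sᶜ, u i * (NormedSpace.exp (s • (R - 1)) *ᵥ x) i) (Set.Ici 0) := by
    refine monotoneOn_of_deriv_nonneg (convex_Ici 0)
      (fun s _ => (hd s).continuousAt.continuousWithinAt)
      (fun s _ => (hd s).differentiableAt.differentiableWithinAt) fun s hs => ?_
    rw [interior_Ici] at hs
    rw [(hd s).deriv]
    set y := NormedSpace.exp (s • (R - 1)) *ᵥ x with hy
    have hE := exp_smul_sub_one_nonneg hR.nonneg (le_of_lt hs : 0 ≤ s)
    have hy0 : ∀ i, 0 ≤ y i := fun i => by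
      change 0 ≤ ∑ j, NormedSpace.exp (s • (R - 1)) i j * x j
      refine Finset.sum_nonneg fun j _ => mul_nonneg (hE i j) ?_
      simp only [hx]
      split_ifs
      exacts [(hR.right_pos j).le, le_rfl]
    have hyv : ∀ i, y i ≤ v i := fun i => by
      rw [← congrFun (exp_smul_mulVec_of_mulVec_eq_zero hR.sub_one_mulVec s) i]
      change ∑ j, NormedSpace.exp (s • (R - 1)) i j * x j
        ≤ ∑ j, NormedSpace.exp (s • (R - 1)) i j * v j
      refine Finset.sum_le_sum fun j _ => mul_le_mul_of_nonneg_left ?_ (hE i j)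
      simp only [hx]
      split_ifs
      exacts [le_rfl, (hR.right_pos j).le]
    -- The growth of mass outside `S` splits into inflow from `S`, at most the flow since `y ≤ v`,
    -- and a net term inside `Sᶜ`, nonpositive since `u` is a left eigenvector and `0 ≤ y`.
    have e1 : ∑ i ∈ Sᶜ, u i * ((R - 1) *ᵥ y) i = ∑ i ∈ Sᶜ, ∑ j ∈ S, u i * R i j * y j
        + (∑ j ∈ Sᶜ, (∑ i ∈ Sᶜ, u i * R i j) * y j - ∑ j ∈ Sᶜ, u j * y j) := by
      have e2 : ∑ j ∈ Sᶜ, (∑ i ∈ Sᶜ, u i * R i j) * y j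
          = ∑ i ∈ Sᶜ, ∑ j ∈ Sᶜ, u i * R i j * y j := by
        rw [Finset.sum_comm]
        simp only [Finset.sum_mul]
      rw [e2, ← add_sub_assoc, ← Finset.sum_add_distrib, ← Finset.sum_sub_distrib]
      refine Finset.sum_congr rfl fun i _ => ?_
      rw [Finset.sum_add_sum_compl, Matrix.sub_mulVec, Matrix.one_mulVec, Pi.sub_apply, mul_sub,
        Matrix.mulVec, dotProduct, Finset.mul_sum]
      simp only [mul_assoc]
    have e3 : ∑ i ∈ Sᶜ, ∑ j ∈ S, u i * R i j * y j ≤ flow R u v S Sᶜ := by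
      rw [← hR.flow_compl_comm]
      exact Finset.sum_le_sum fun i _ => Finset.sum_le_sum fun j _ =>
        mul_le_mul_of_nonneg_left (hyv j) (mul_nonneg (hR.left_pos i).le (hR.nonneg i j))
    have e4 : ∑ j ∈ Sᶜ, (∑ i ∈ Sᶜ, u i * R i j) * y j ≤ ∑ j ∈ Sᶜ, u j * y j := by
      refine Finset.sum_le_sum fun j _ => mul_le_mul_of_nonneg_right ?_ (hy0 j)
      rw [← congrFun hR.left_eigen j]
      exact Finset.sum_le_sum_of_subset_of_nonneg (Finset.subset_univ _)
        fun i _ _ => mul_nonneg (hR.left_pos i).le (hR.nonneg i j)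
    linarith
  have h := hmono (Set.mem_Ici.2 le_rfl) (Set.mem_Ici.2 ht) ht
  have h0 : ∑ i ∈ Sᶜ, u i * (NormedSpace.exp ((0 : ℝ) • (R - 1)) *ᵥ x) i = 0 := by
    refine Finset.sum_eq_zero fun i hi => ?_
    have : i ∉ S := by simpa using hi
    simp [hx, this]
  simp only [h0, zero_mul, sub_zero] at h
  linarith

theorem half_sub_le_of_mem_mixedTimes (hR : IsPFPair R u v) (hn : 2 ≤ n) {t : ℝ}
    (ht : t ∈ mixedTimes R u v ε) : 1 / 2 - ε ≤ edgeExpansion R u v * t := by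
  obtain ⟨S, hS, hhalf, hflow⟩ := hR.exists_cut hn
  obtain ⟨ht0, hmix⟩ := ht
  set p := ∑ i ∈ S, u i * v i with hp
  have hp0 : 0 < p := hR.sum_mass_pos hS
  set x : Fin n → ℝ := fun i => if i ∈ S then v i else 0 with hx
  have hx0 : ∀ i, 0 ≤ x i := fun i => by
    simp only [hx]
    split_ifs
    exacts [(hR.right_pos i).le, le_rfl]
  have hux : u ⬝ᵥ x = p := by
    simp [dotProduct, hx, hp]
  have hnorm : weightedL1 u (p⁻¹ • x) = 1 := by
    rw [weightedL1_eq hR.left_pos, ← inv_mul_cancel₀ hp0.ne']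
    nth_rewrite 3 [← hux]
    rw [dotProduct, Finset.mul_sum]
    refine Finset.sum_congr rfl fun i _ => ?_
    rw [Pi.smul_apply, smul_eq_mul, abs_of_nonneg (mul_nonneg (inv_pos.2 hp0).le (hx0 i))]
    ring
  have h := hmix _ hnorm
  have hesc := hR.sum_compl_exp_smul_mulVec_le S ht0
  rw [hflow] at hesc
  -- Only the coordinates outside `S` are kept: there the limit has mass `1 - p`, and the evolved
  -- vector only what has escaped.
  have hlow : (1 - p) - p⁻¹ * ∑ i ∈ Sᶜ, u i * (NormedSpace.exp (t • (R - 1)) *ᵥ x) i ≤ ε := by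
    refine le_trans ?_ h
    rw [weightedL1_eq hR.left_pos, ← hR.sum_mass_compl, Finset.mul_sum, ← Finset.sum_sub_distrib]
    refine le_trans (Finset.sum_le_sum fun i _ => ?_)
      (Finset.sum_le_sum_of_subset_of_nonneg (Finset.subset_univ Sᶜ)
        fun i _ _ => mul_nonneg (hR.left_pos i).le (abs_nonneg _))
    rw [sub_vecMulVec_mulVec, Matrix.mulVec_smul, dotProduct_smul, hux, smul_eq_mul,
      inv_mul_cancel₀ hp0.ne', Pi.smul_apply, smul_eq_mul]
    have := mul_le_mul_of_nonneg_left
      (neg_abs_le (p⁻¹ * (NormedSpace.exp (t • (R - 1)) *ᵥ x) i - v i * 1)) (hR.left_pos i).le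
    linarith
  have h5 : p⁻¹ * ∑ i ∈ Sᶜ, u i * (NormedSpace.exp (t • (R - 1)) *ᵥ x) i
      ≤ edgeExpansion R u v * t := by
    rw [inv_mul_le_iff₀ hp0]
    linarith
  linarith

end IsPFPair

end NonnegMatrix

theorem lemma5p6 (n : ℕ) (hn : 2 ≤ n) (R : Matrix (Fin n) (Fin n) ℝ) (u v : Fin n → ℝ)
    (hR : NonnegMatrix.IsPFPair R u v) (ε : ℝ) (hε : 0 < ε)
    (hε' : ε ≤ n / NonnegMatrix.kappa u v) :
    (0 < NonnegMatrix.edgeExpansion R u v →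
      (∃ τ : ℝ, NonnegMatrix.IsContinuousMixingTime R u v ε τ ∧
        (1 / 2 - ε) / NonnegMatrix.edgeExpansion R u v ≤ τ ∧
        τ ≤ 100 * Real.log (n / (NonnegMatrix.kappa u v * ε)) /
          NonnegMatrix.edgeExpansion R u v ^ 2) ∧
      (∃ k : ℕ, NonnegMatrix.IsMixingTime (NormedSpace.exp (R - 1)) u v ε k ∧
        (1 / 2 - ε) / NonnegMatrix.edgeExpansion R u v ≤ k ∧
        k ≤ 100 * Real.log (n / (NonnegMatrix.kappa u v * ε)) /
          NonnegMatrix.edgeExpansion R u v ^ 2)) ∧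
    (NonnegMatrix.edgeExpansion R u v = 0 → ε < 1 / 2 →
      NonnegMatrix.mixedTimes R u v ε = ∅ ∧
      NonnegMatrix.mixedSteps (NormedSpace.exp (R - 1)) u v ε = ∅) := by
  refine ⟨fun hφ => ?_, fun hφ hε2 => ?_⟩
  · obtain ⟨k, hk, hkle⟩ := hR.exists_mixedSteps_le hn hε hε' hφ
    have hlower : ∀ t ∈ NonnegMatrix.mixedTimes R u v ε,
        (1 / 2 - ε) / NonnegMatrix.edgeExpansion R u v ≤ t := fun t ht =>
      (div_le_iff₀' hφ).2 (hR.half_sub_le_of_mem_mixedTimes hn ht)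
    have hkt := (NonnegMatrix.mem_mixedSteps_exp_iff k).1 hk
    refine ⟨?_, ?_⟩
    -- The integer mixed time `k` also witnesses nonemptiness here and transfers its upper bound to
    -- the continuous minimum.
    · have hleast := NonnegMatrix.isClosed_mixedTimes.isLeast_csInf ⟨_, hkt⟩ ⟨0, fun t ht => ht.1⟩
      exact ⟨_, hleast, hlower _ hleast.1, (hleast.2 hkt).trans hkle⟩
    · have hleast : IsLeast (NonnegMatrix.mixedSteps (NormedSpace.exp (R - 1)) u v ε) (sInf _) :=
        ⟨Nat.sInf_mem ⟨k, hk⟩, fun m hm => Nat.sInf_le hm⟩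
      exact ⟨_, hleast, hlower _ ((NonnegMatrix.mem_mixedSteps_exp_iff _).1 hleast.1),
        (Nat.cast_le.2 (hleast.2 hk)).trans hkle⟩
  · have hempty : ∀ t, t ∉ NonnegMatrix.mixedTimes R u v ε := fun t ht => by
      have := hR.half_sub_le_of_mem_mixedTimes hn ht
      rw [hφ, zero_mul] at this
      linarith
    exact ⟨Set.eq_empty_of_forall_notMem hempty, Set.eq_empty_of_forall_notMem fun k hk =>
      hempty k ((NonnegMatrix.mem_mixedSteps_exp_iff k).1 hk)⟩
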